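/- Computability on Cantor space $\{0,1\}^{\mathbb N}$ is Type-2 computability, and a represented space is a set with a partial surjection from $\{0,1\}^{\mathbb N}$ onto it (its representation; preimages of a point are its names). For represented spaces $\mathbf A,\mathbf B$ let $\mathcal C(\mathbf A,\mathbf B)$ be the represented space of continuous (that is, continuously realizable) functions, $\mathcal O(\mathbf A)\cong\mathcal C(\mathbf A,\mathbb S)$ the space of open subsets ($\mathbb S$ is the Sierpiński space), and $\mathcal A(\mathbf A)$ the space of closed subsets, each represented by the names of its complement in $\mathcal O(\mathbf A)$. A computable metric space is a metric space with a dense sequence whose mutual distances are computable reals uniformly in the indices; it carries its Cauchy representation. For a computable metric space $\mathbf X$, the represented space $\Delta^0_2(\mathbf X)$ consists of the sets $D\subseteq X$ named by (the names of) sequences $(A_i,U_i)_{i\in\mathbb N}\in\mathcal C(\mathbb N,\mathcal A(\mathbf X)\times\mathcal O(\mathbf X))$ with $D=\bigcup_i A_i=\bigcap_i U_i$. For computable metric spaces $\mathbf X,\mathbf Y$, the represented space $\Delta^0_2(\mathbf X,\mathbf Y)$ consists of the functions $f:X\to Y$ for which $f^{-1}$ is an element of $\mathcal C(\mathcal O(\mathbf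 Y),\Delta^0_2(\mathbf X))$; the names of $f$ are the names of $f^{-1}$ in that space. Closed choice on $\mathbb N$ is the multivalued partial function $C_{\mathbb N}:\subseteq\mathcal A(\mathbb N)\rightrightarrows\mathbb N$ whose domain is the set of nonempty $A\in\mathcal A(\mathbb N)$, with $n\in C_{\mathbb N}(A)$ iff $n\in A$. For multivalued partial functions $f,g$ between represented spaces, $f\leq_{\mathrm W}g$ means that there are computable $H,K:\subseteq\{0,1\}^{\mathbb N}\to\{0,1\}^{\mathbb N}$ such that for every realizer $G$ of $g$ the map $p\mapsto H(\langle p,GK(p)\rangle)$ is a realizer of $f$. Theorem. Let $\mathbf X,\mathbf Y$ be computable metric spaces. The function $\mathrm{Eval}:\Delta^0_2(\mathbf X,\mathbf Y)\times\mathbf X\to\mathbf Y$, $\mathrm{Eval}(f,x)=f(x)$, satisfies $\mathrm{Eval}\leq_{\mathrm W}C_{\mathbb N}$. -/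

import Mathlib

universe u v w z

namespace CompAnalysis

/-! ### Computability on Cantor space -/

/-- Cantor space `{0,1}^ℕ`. -/
abbrev Cantor : Type := ℕ → Bool

/-- The finite prefix of length `n` of an infinite sequence. -/
def Cantor.pre (p : Cantor) (n : ℕ) : List Bool := (List.range n).map p

/-- The even and odd parts of a sequence, and the pairing `⟨p, q⟩` with these parts. -/
def Cantor.left (r : Cantor) : Cantor := fun n => r (2 * n)

def Cantor.right (r : Cantor) : Cantor := fun n => r (2 * n + 1)

def Cantor.pair (p q : Cantor) : Cantor := fun n => if n % 2 = 0 then p (n / 2) else q (n / 2)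

/-- A word function that is monotone for the prefix order. It is the transition behaviour of a
Type-2 machine: `φ w` is the word that stands on the one-way output tape after `|w|` steps, when
at most the prefix `w` of the input has been read. -/
def MonoWord (φ : List Bool → List Bool) : Prop := ∀ ⦃v w⦄, v <+: w → φ v <+: φ w

/-- `Produces φ p q`: on input `p` the (monotone) word function `φ` writes the infinite sequence
`q`, that is, the words `φ (p.pre n)` converge to `q`. -/
def Produces (φ : List Bool → List Bool) (p q : Cantor) : Prop :=
  ∀ m, ∃ n, q.pre m <+: φ (p.pre n)

/-- A partial function `F :⊆ {0,1}^ℕ → {0,1}^ℕ` is computable if a Type-2 machine computes it: on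
every input in the domain of `F` the machine writes the value of `F`. -/
def ComputableFun (F : Cantor →. Cantor) : Prop :=
  ∃ φ : List Bool → List Bool, Computable φ ∧ MonoWord φ ∧ ∀ p q, q ∈ F p → Produces φ p q

lemma Cantor.pre_length (p : Cantor) (n : ℕ) : (p.pre n).length = n := by simp [Cantor.pre]

lemma Cantor.pre_prefix (p : Cantor) {m n : ℕ} (h : m ≤ n) : p.pre m <+: p.pre n := by
  obtain ⟨k, rfl⟩ := Nat.exists_eq_add_of_le h
  simp [Cantor.pre, List.range_add]

lemma Produces.unique {φ : List Bool → List Bool} (hφ : MonoWord φ) {p q q' : Cantor}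
    (h : Produces φ p q) (h' : Produces φ p q') : q = q' := by
  funext i
  obtain ⟨n, hn⟩ := h (i + 1)
  obtain ⟨n', hn'⟩ := h' (i + 1)
  have a := hn.trans (hφ (p.pre_prefix (le_max_left n n')))
  have a' := hn'.trans (hφ (p.pre_prefix (le_max_right n n')))
  have e : q.pre (i + 1) = q'.pre (i + 1) :=
    (List.prefix_of_prefix_length_le a a' (by simp [Cantor.pre])).eq_of_length
      (by simp [Cantor.pre])
  have := congrArg (fun l => l[i]?) e
  simpa [Cantor.pre] using this

/-! ### Represented spaces and Weihrauch reducibility -/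

/-- A representation of `X`: a partial surjection `δ :⊆ {0,1}^ℕ → X`, given by its graph;
`names p x` means `p ∈ dom δ` and `δ p = x`. -/
structure Representation (X : Type u) where
  names : Cantor → X → Prop
  unique : ∀ {p x y}, names p x → names p y → x = y
  surj : ∀ x, ∃ p, names p x

/-- A multivalued partial function `f :⊆ X ⇉ Y` is a map `X → Set Y`; its domain is the set of
points with nonempty value. `Realizes` says that `G` is a realizer of `f`. -/
def Realizes {X : Type u} {Y : Type v} (ρX : Representation X) (ρY : Representation Y)
    (G : Cantor →. Cantor) (f : X → Set Y) : Prop :=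
  ∀ p x, ρX.names p x → (f x).Nonempty → ∃ q ∈ G p, ∃ y ∈ f x, ρY.names q y

/-- Weihrauch reducibility `f ≤_W g`. -/
def WeihrauchReducible {X : Type u} {Y : Type v} {U : Type w} {V : Type z}
    (ρX : Representation X) (ρY : Representation Y) (ρU : Representation U)
    (ρV : Representation V) (f : X → Set Y) (g : U → Set V) : Prop :=
  ∃ H K : Cantor →. Cantor, ComputableFun H ∧ ComputableFun K ∧
    ∀ G : Cantor →. Cantor, Realizes ρU ρV G g →
      Realizes ρX ρY (fun p => (K p).bind fun k => (G k).bind fun r => H (p.pair r)) f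

/-! ### Basic constructions -/

/-- The product of two represented spaces: `⟨p, q⟩` names `(x, y)` if `p` names `x` and `q`
names `y`. -/
def prodRep {X : Type u} {Y : Type v} (ρX : Representation X) (ρY : Representation Y) :
    Representation (X × Y) where
  names r x := ρX.names r.left x.1 ∧ ρY.names r.right x.2
  unique h h' := Prod.ext (ρX.unique h.1 h'.1) (ρY.unique h.2 h'.2)
  surj x := by
    obtain ⟨p, hp⟩ := ρX.surj x.1
    obtain ⟨q, hq⟩ := ρY.surj x.2
    have e1 : (p.pair q).left = p := by funext n; simp [Cantor.left, Cantor.pair]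
    have e2 : (p.pair q).right = q := by
      funext n
      simp only [Cantor.right, Cantor.pair]
      rw [if_neg (by omega), show (2 * n + 1) / 2 = n by omega]
    exact ⟨p.pair q, by rwa [e1], by rwa [e2]⟩

/-- The natural numbers: `n` has the single name `0^n 1 0^ω`. -/
def natRep : Representation ℕ where
  names p n := ∀ i, p i = true ↔ i = n
  unique {_ x _} h h' := (h' x).1 ((h x).2 rfl)
  surj n := ⟨fun i => decide (i = n), by simp⟩

/-- The Sierpiński space: `⊥` is named by `0^ω` only, `⊤` by all other sequences. -/
def sierpinskiRep : Representation Prop where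
  names p s := s ↔ ∃ i, p i = true
  unique h h' := propext (h.trans h'.symm)
  surj s := by
    classical
    exact ⟨fun _ => decide s, by simp⟩

/-- `φ` realizes the total function `f : X → Y`. -/
def WordRealizes {X : Type u} {Y : Type v} (ρX : Representation X) (ρY : Representation Y)
    (φ : List Bool → List Bool) (f : X → Y) : Prop :=
  ∀ p x, ρX.names p x → ∃ q, Produces φ p q ∧ ρY.names q (f x)

/-- `p` encodes the word function `φ` through the characteristic function of its graph. -/
def EncodesWord (p : Cantor) (φ : List Bool → List Bool) : Prop :=
  ∀ v w : List Bool, p (Encodable.encode (v, w)) = true ↔ φ v = w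

/-- `p` is a name of the continuous function `f`: it encodes a monotone word function that
realizes `f`. (These are the possible behaviours of Type-2 machines with an arbitrary oracle, so
this is the usual function space representation up to computable translation.) -/
def NamesFun {X : Type u} {Y : Type v} (ρX : Representation X) (ρY : Representation Y)
    (p : Cantor) (f : X → Y) : Prop :=
  ∃ φ, MonoWord φ ∧ EncodesWord p φ ∧ WordRealizes ρX ρY φ f

lemma NamesFun.unique {X : Type u} {Y : Type v} {ρX : Representation X} {ρY : Representation Y}
    {p : Cantor} {f g : X → Y} (hf : NamesFun ρX ρY p f) (hg : NamesFun ρX ρY p g) : f = g := by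
  obtain ⟨φ, hφ, c, r⟩ := hf
  obtain ⟨ψ, -, c', r'⟩ := hg
  have e : ψ = φ := by
    funext v
    exact (c' v (φ v)).1 ((c v (φ v)).2 rfl)
  subst e
  funext x
  obtain ⟨a, ha⟩ := ρX.surj x
  obtain ⟨q, h1, h2⟩ := r a x ha
  obtain ⟨q', h1', h2'⟩ := r' a x ha
  rw [h1.unique hφ h1'] at h2
  exact ρY.unique h2 h2'

/-- The set of continuous (that is, continuously realizable) functions `X → Y`. -/
def ContFun {X : Type u} {Y : Type v} (ρX : Representation X) (ρY : Representation Y) :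
    Type (max u v) :=
  {f : X → Y // ∃ p, NamesFun ρX ρY p f}

/-- The represented space `𝒞(X, Y)`. -/
def contRep {X : Type u} {Y : Type v} (ρX : Representation X) (ρY : Representation Y) :
    Representation (ContFun ρX ρY) where
  names p f := NamesFun ρX ρY p f.1
  unique h h' := Subtype.ext (h.unique h')
  surj f := f.2

/-- The open subsets of a represented space: the sets with continuous characteristic function into
the Sierpiński space. -/
def OpenSet {X : Type u} (ρX : Representation X) : Type u :=
  {U : Set X // ∃ p, NamesFun ρX sierpinskiRep p (fun x => x ∈ U)}

/-- The represented space `𝒪(X)`, which is `𝒞(X, 𝕊)` up to identifying a set with its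
characteristic function. -/
def openRep {X : Type u} (ρX : Representation X) : Representation (OpenSet ρX) where
  names p U := NamesFun ρX sierpinskiRep p (fun x => x ∈ U.1)
  unique h h' := Subtype.ext (Set.ext fun x => iff_of_eq (congrFun (h.unique h') x))
  surj U := U.2

/-- The closed subsets of a represented space: the complements of open sets. -/
def ClosedSet {X : Type u} (ρX : Representation X) : Type u :=
  {A : Set X // ∃ p, NamesFun ρX sierpinskiRep p (fun x => x ∈ Aᶜ)}

/-- The represented space `𝒜(X)`: a name of `A` is a name of the open set `Aᶜ`. -/
def closedRep {X : Type u} (ρX : Representation X) : Representation (ClosedSet ρX) where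
  names p A := NamesFun ρX sierpinskiRep p (fun x => x ∈ A.1ᶜ)
  unique h h' := Subtype.ext (compl_injective
    (Set.ext fun x => iff_of_eq (congrFun (h.unique h') x)))
  surj A := A.2

/-- Closed choice `C_X :⊆ 𝒜(X) ⇉ X`, `x ∈ C_X(A) ↔ x ∈ A`; its domain consists of the nonempty
closed sets. -/
def closedChoice {X : Type u} (ρX : Representation X) : ClosedSet ρX → Set X := fun A => A.1

/-! ### Computable metric spaces -/

/-- A computable metric space: a metric space with a dense sequence such that the distances
between its points are computable real numbers, uniformly in the indices. -/
class ComputableMetricSpace (X : Type u) extends MetricSpace X where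
  point : ℕ → X
  dense_point : DenseRange point
  computable_dist : ∃ a : ℕ × ℕ × ℕ → ℕ, Computable a ∧
    ∀ i j k, |dist (point i) (point j) - (a (i, j, k) : ℝ) / 2 ^ k| ≤ 1 / 2 ^ k

/-- `p` encodes `s : ℕ → ℕ` through the characteristic function of its graph. -/
def EncodesSeq (p : Cantor) (s : ℕ → ℕ) : Prop :=
  ∀ k n : ℕ, p (Nat.pair k n) = true ↔ s k = n

lemma EncodesSeq.exists (s : ℕ → ℕ) : ∃ p, EncodesSeq p s :=
  ⟨fun i => decide (s i.unpair.1 = i.unpair.2), fun k n => by simp⟩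

/-- The Cauchy representation: a name of `x` encodes a sequence of indices of points of the dense
sequence that converges rapidly to `x`. -/
def cauchyRep (X : Type u) [ComputableMetricSpace X] : Representation X where
  names p x := ∃ s : ℕ → ℕ, EncodesSeq p s ∧
    ∀ k, dist (ComputableMetricSpace.point (s k)) x ≤ 1 / 2 ^ k
  unique := by
    rintro p x y ⟨s, hs, h⟩ ⟨t, ht, h'⟩
    have e : t = s := by
      funext k
      exact (ht k (s k)).1 ((hs k (s k)).2 rfl)
    subst e
    refine tendsto_nhds_unique (f := fun k => (ComputableMetricSpace.point (t k) : X))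
      (l := Filter.atTop) ?_ ?_ <;>
    · rw [tendsto_iff_dist_tendsto_zero]
      refine squeeze_zero (fun _ => dist_nonneg) (by assumption) ?_
      simpa using tendsto_pow_atTop_nhds_zero_of_lt_one (r := (1 / 2 : ℝ)) (by norm_num)
        (by norm_num)
  surj x := by
    have : ∀ k : ℕ, ∃ n : ℕ, dist (ComputableMetricSpace.point n : X) x ≤ 1 / 2 ^ k := by
      intro k
      obtain ⟨n, hn⟩ := (ComputableMetricSpace.dense_point (X := X)).exists_dist_lt x
        (show (0 : ℝ) < 1 / 2 ^ k by positivity)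
      exact ⟨n, by rw [dist_comm]; exact hn.le⟩
    choose s hs using this
    obtain ⟨p, hp⟩ := EncodesSeq.exists s
    exact ⟨p, s, hp, hs⟩

/-- Points of a represented space that belong to the same open sets are equal. -/
def IsT0 {X : Type u} (ρX : Representation X) : Prop :=
  ∀ x y : X, (∀ U : OpenSet ρX, x ∈ U.1 ↔ y ∈ U.1) → x = y

lemma cauchyRep_isT0 (X : Type u) [ComputableMetricSpace X] : IsT0 (cauchyRep X) := by
  classical
  intro x₀ y₀ hU
  by_contra hne
  let bad : List Bool → Prop := fun w => ∃ k n : ℕ, w[Nat.pair k n]? = some true ∧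
    1 / 2 ^ k < dist (ComputableMetricSpace.point n : X) x₀
  let φ : List Bool → List Bool := fun w =>
    (List.range w.length).map fun i => decide (bad (w.take i))
  have hφ : MonoWord φ := by
    rintro v _ ⟨t, rfl⟩
    simp only [φ, List.length_append, List.range_add, List.map_append]
    refine ⟨_, congrArg₂ (· ++ ·) (List.map_congr_left fun i hi => ?_) rfl⟩
    rw [List.take_append_of_le_length (List.mem_range.1 hi).le]
  have hr : WordRealizes (cauchyRep X) sierpinskiRep φ (fun x => x ∈ ({x₀}ᶜ : Set X)) := by
    rintro p x ⟨s, hs, hx⟩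
    have hpre : ∀ n, φ (p.pre n) = Cantor.pre (fun i => decide (bad (p.pre i))) n := by
      intro n
      simp only [φ, Cantor.pre, List.length_map, List.length_range]
      refine List.map_congr_left fun i hi => ?_
      rw [← List.map_take, List.take_range, min_eq_left (List.mem_range.1 hi).le]
      rfl
    refine ⟨fun i => decide (bad (p.pre i)), fun m => ⟨m, by rw [hpre]⟩, ?_⟩
    change x ∈ ({x₀}ᶜ : Set X) ↔ ∃ i, decide (bad (p.pre i)) = true
    simp only [decide_eq_true_eq, Set.mem_compl_iff, Set.mem_singleton_iff]
    constructor
    · intro hxx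
      have hd : 0 < dist x x₀ := dist_pos.2 hxx
      obtain ⟨k, hk⟩ := exists_pow_lt_of_lt_one (half_pos hd) (show (1 / 2 : ℝ) < 1 by norm_num)
      rw [one_div, inv_pow, ← one_div] at hk
      refine ⟨Nat.pair k (s k) + 1, k, s k, ?_, ?_⟩
      · simp [Cantor.pre, (hs k (s k)).2 rfl]
      · have := dist_triangle_left x x₀ (ComputableMetricSpace.point (s k) : X)
        linarith [hx k]
    · rintro ⟨i, k, n, hb, hd⟩ rfl
      have : p (Nat.pair k n) = true := by
        simp only [Cantor.pre, List.getElem?_map, Option.map_eq_some_iff] at hb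
        obtain ⟨a, ha, hb⟩ := hb
        rw [List.getElem?_eq_some_iff] at ha
        obtain ⟨h1, h2⟩ := ha
        simp at h2
        rw [h2]; exact hb
      have e := (hs k n).1 this
      subst e
      exact absurd (hx k) (not_le.2 hd)
  let p : Cantor := fun i =>
    match (Encodable.decode i : Option (List Bool × List Bool)) with
    | some a => decide (φ a.1 = a.2)
    | none => false
  have hp : EncodesWord p φ := fun v w => by simp [p]
  exact absurd ((hU ⟨{x₀}ᶜ, p, φ, hφ, hp, hr⟩).2 (fun h => hne (Eq.symm h))) (by simp)

/-! ### `Δ⁰₂`-sets and `Δ⁰₂`-measurable functions -/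

/-- `p` is a name of `D` as a `Δ⁰₂`-set: it names a sequence `(A_i, U_i)` in
`𝒞(ℕ, 𝒜(X) × 𝒪(X))` with `⋃ A_i = D = ⋂ U_i`. -/
def NamesDelta2 {X : Type u} (ρX : Representation X) (p : Cantor) (D : Set X) : Prop :=
  ∃ s : ContFun natRep (prodRep (closedRep ρX) (openRep ρX)),
    (contRep natRep (prodRep (closedRep ρX) (openRep ρX))).names p s ∧
    D = ⋃ i, (s.1 i).1.1 ∧ D = ⋂ i, (s.1 i).2.1

def Delta2Set {X : Type u} (ρX : Representation X) : Type u :=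
  {D : Set X // ∃ p, NamesDelta2 ρX p D}

/-- The represented space `Δ⁰₂(X)`. -/
def delta2SetRep {X : Type u} (ρX : Representation X) : Representation (Delta2Set ρX) where
  names p D := NamesDelta2 ρX p D.1
  unique := by
    rintro p D E ⟨s, hs, hD, -⟩ ⟨t, ht, hE, -⟩
    have := (contRep natRep (prodRep (closedRep ρX) (openRep ρX))).unique hs ht
    subst this
    exact Subtype.ext (hD.trans hE.symm)
  surj D := D.2

/-- `p` is a name of `f` as a `Δ⁰₂`-measurable function: it names the function
`f⁻¹ : 𝒪(Y) → Δ⁰₂(X)` as an element of `𝒞(𝒪(Y), Δ⁰₂(X))`. -/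
def NamesDelta2Fun {X : Type u} {Y : Type v} (ρX : Representation X) (ρY : Representation Y)
    (p : Cantor) (f : X → Y) : Prop :=
  ∃ g : ContFun (openRep ρY) (delta2SetRep ρX),
    (contRep (openRep ρY) (delta2SetRep ρX)).names p g ∧ ∀ U, (g.1 U).1 = f ⁻¹' U.1

def Delta2Fun {X : Type u} {Y : Type v} (ρX : Representation X) (ρY : Representation Y) :
    Type (max u v) :=
  {f : X → Y // ∃ p, NamesDelta2Fun ρX ρY p f}

/-- The represented space `Δ⁰₂(X, Y)`; a function is identified with its preimage map, which
determines it because `Y` is `T₀`. -/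
def delta2FunRep {X : Type u} {Y : Type v} (ρX : Representation X) (ρY : Representation Y)
    (hY : IsT0 ρY) : Representation (Delta2Fun ρX ρY) where
  names p f := NamesDelta2Fun ρX ρY p f.1
  unique := by
    rintro p f f' ⟨g, hg, h⟩ ⟨g', hg', h'⟩
    have := (contRep (openRep ρY) (delta2SetRep ρX)).unique hg hg'
    subst this
    refine Subtype.ext (funext fun x => hY _ _ fun U => ?_)
    exact Set.ext_iff.1 ((h U).symm.trans (h' U)) x
  surj f := f.2

/-- Evaluation `Δ⁰₂(X, Y) × X → Y`, `(f, x) ↦ f x`, as a single-valued total problem. -/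
def delta2Eval {X : Type u} {Y : Type v} (ρX : Representation X) (ρY : Representation Y) :
    Delta2Fun ρX ρY × X → Set Y := fun a => {a.1.1 a.2}

end CompAnalysis

/-! A single number suffices as advice for evaluating `f` at `x`. A sequence `e` of rational balls
has a computable name as the open set `⋃ j, e j`, in which prefixes depend on prefixes of `e` only.
The name of `f` turns it into a sequence of open sets `V i` with `f ⁻¹' (⋃ j, e j) = ⋂ i, V i`, and
`x ∈ V i` is accepted after finitely many balls have been listed. Let the pair `(i, w)` of an index
and a finite list of balls accept the ball `B` if `x ∈ V i` is accepted for the list `w` followed by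
some repetitions of `B`. Every pair accepts every ball that contains `f x` (`exists_acceptsBall`).

Reject `(i, w)` if it accepts two balls that are seen to be disjoint. This can be semidecided, so
that the pairs that are not rejected form a closed set of natural numbers (`namesFun_rejected`). It
is nonempty by a Baire category argument (`exists_not_rejects`): if all pairs were rejected, then at
each stage `i` the list built so far could be continued by an accepted ball that avoids `f x`; in the
limit `x ∈ V i` for all `i`, hence `f x ∈ ⋃ j, e j`, although no listed ball contains `f x`.

A pair that is not rejected accepts only balls whose closure contains `f x`, since it also accepts
arbitrarily small balls around `f x` (`dist_le_of_acceptsBall`). So, given such a pair, which is what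
closed choice provides, a search for accepted balls of radius `2 ^ (-k)` for all `k`
(`exists_search_machine`) computes a Cauchy name of `f x`.
-/

namespace CompAnalysis

/-! ### Computable functions on words -/

lemma computable_map_range {α σ : Type*} [Primcodable α] [Primcodable σ] {g : α → ℕ}
    {f : α → ℕ → σ} (hg : Computable g) (hf : Computable₂ f) :
    Computable fun a => (List.range (g a)).map (f a) := by
  have h : Computable₂ fun (a : α) (x : ℕ × List σ) => x.2 ++ [f a x.1] :=
    Computable.list_concat.comp (Computable.snd.comp Computable.snd)
      (hf.comp Computable.fst (Computable.fst.comp Computable.snd))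
  refine (Computable.nat_rec hg (Computable.const []) h).of_eq fun a => ?_
  induction g a with
  | zero => rfl
  | succ n ih => simp [List.range_succ, ih]

lemma computable_decide_eq {α β : Type*} [Primcodable α] [Primcodable β] [DecidableEq β]
    {f g : α → β} (hf : Computable f) (hg : Computable g) :
    Computable fun a => decide (f a = g a) :=
  ((Primrec.eq (α := β)).decide.to_comp).comp hf hg

lemma computable_and {α : Type*} [Primcodable α] {f g : α → Bool} (hf : Computable f)
    (hg : Computable g) : Computable fun a => f a && g a :=
  Primrec.and.to_comp.comp hf hg

lemma computable_decide_lt {α : Type*} [Primcodable α] {f g : α → ℕ} (hf : Computable f)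
    (hg : Computable g) : Computable fun a => decide (f a < g a) :=
  (Primrec.nat_lt.decide.to_comp).comp hf hg

lemma Cantor.eq_pre_of_prefix (p : Cantor) (n : ℕ) (w : List Bool) (h : w <+: p.pre n) :
    w = p.pre w.length := by
  have hl : w.length ≤ n := by simpa [Cantor.pre] using h.length_le
  exact (List.prefix_of_prefix_length_le h (p.pre_prefix hl) (by simp [Cantor.pre])).eq_of_length
    (by simp [Cantor.pre])

lemma Cantor.take_pre (p : Cantor) {m n : ℕ} (h : m ≤ n) : (p.pre n).take m = p.pre m := by
  simp [Cantor.pre, ← List.map_take, List.take_range, h]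

lemma Cantor.getElem?_pre (p : Cantor) (n i : ℕ) :
    (p.pre n)[i]? = if i < n then some (p i) else none := by
  by_cases h : i < n <;> simp [Cantor.pre, h]

lemma Cantor.getElem?_pre_eq_some_true {p : Cantor} {n i : ℕ} :
    (p.pre n)[i]? = some true ↔ i < n ∧ p i = true := by
  rw [p.getElem?_pre]; by_cases h : i < n <;> simp [h]

/-- A monotone word function only ever writes prefixes of its final output. -/
lemma Produces.eq_pre {φ : List Bool → List Bool} (hφ : MonoWord φ) {p q : Cantor}
    (h : Produces φ p q) (n : ℕ) : φ (p.pre n) = q.pre (φ (p.pre n)).length := by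
  obtain ⟨n', hn'⟩ := h (φ (p.pre n)).length
  have a := hφ (p.pre_prefix (le_max_left n n'))
  have b := hn'.trans (hφ (p.pre_prefix (le_max_right n n')))
  exact (List.prefix_of_prefix_length_le a b (by simp [Cantor.pre])).eq_of_length
    (by simp [Cantor.pre])

/-- Once the output is long enough, it stays so: production can be postponed. -/
lemma Produces.exists_ge {φ : List Bool → List Bool} (hφ : MonoWord φ) {p q : Cantor}
    (h : Produces φ p q) (m N : ℕ) :
    ∃ n, N ≤ n ∧ q.pre m <+: φ (p.pre n) := by
  obtain ⟨n, hn⟩ := h m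
  exact ⟨max N n, le_max_left _ _, hn.trans (hφ (p.pre_prefix (le_max_right _ _)))⟩

lemma Cantor.left_pair (p q : Cantor) : (p.pair q).left = p := by
  funext n; simp [Cantor.left, Cantor.pair]

lemma Cantor.right_pair (p q : Cantor) : (p.pair q).right = q := by
  funext n
  simp only [Cantor.right, Cantor.pair]
  rw [if_neg (by omega), show (2 * n + 1) / 2 = n by omega]

/-- The entries of a word at even positions; an unpaired last entry is dropped, so that prefixes of
`p.pair q` of length `n` give prefixes of `p` and `q` of the same length `n / 2`. -/
def leftWord (w : List Bool) : List Bool :=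
  (List.range (w.length / 2)).map fun i => w.getD (2 * i) false

/-- The entries of a word at odd positions. -/
def rightWord (w : List Bool) : List Bool :=
  (List.range (w.length / 2)).map fun i => w.getD (2 * i + 1) false

lemma leftWord_pre (r : Cantor) (n : ℕ) : leftWord (r.pre n) = r.left.pre (n / 2) := by
  simp only [leftWord, Cantor.pre_length]
  refine List.map_congr_left fun i hi => ?_
  have := List.mem_range.1 hi
  rw [List.getD_eq_getElem?_getD, r.getElem?_pre, if_pos (by omega)]; rfl

lemma rightWord_pre (r : Cantor) (n : ℕ) : rightWord (r.pre n) = r.right.pre (n / 2) := by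
  simp only [rightWord, Cantor.pre_length]
  refine List.map_congr_left fun i hi => ?_
  have := List.mem_range.1 hi
  rw [List.getD_eq_getElem?_getD, r.getElem?_pre, if_pos (by omega)]; rfl

lemma computable_leftWord : Computable leftWord :=
  computable_map_range
    ((Primrec.nat_div.comp Primrec.list_length (Primrec.const 2)).to_comp)
    (Computable₂.comp (f := fun (l : List Bool) n => l.getD n false)
      (Primrec.list_getD false).to_comp Computable.fst
      (Primrec.nat_mul.comp (Primrec.const 2) Primrec.snd).to_comp)

lemma computable_rightWord : Computable rightWord :=
  computable_map_range
    ((Primrec.nat_div.comp Primrec.list_length (Primrec.const 2)).to_comp)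
    (Computable₂.comp (f := fun (l : List Bool) n => l.getD n false)
      (Primrec.list_getD false).to_comp Computable.fst
      (Primrec.nat_double_succ.comp Primrec.snd).to_comp)

/-! ### Names of word functions -/

/-- The sequence that encodes a word function, in the sense of `EncodesWord`. -/
def graphName (φ : List Bool → List Bool) : Cantor := fun j =>
  ((Encodable.decode₂ (List Bool × List Bool) j).map
    fun vw => decide (φ vw.1 = vw.2)).getD false

lemma encodesWord_graphName (φ : List Bool → List Bool) : EncodesWord (graphName φ) φ := by
  intro v w
  simp only [graphName, Encodable.encodek₂, Option.map_some, Option.getD_some, decide_eq_true_eq]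

/-- An entry of `graphName φ` depends only on the values of `φ` at words no longer than its
index. -/
lemma graphName_congr {φ ψ : List Bool → List Bool} {j : ℕ}
    (h : ∀ v : List Bool, v.length ≤ j → φ v = ψ v) : graphName φ j = graphName ψ j := by
  unfold graphName
  rcases hd : Encodable.decode₂ (List Bool × List Bool) j with _ | ⟨v, w⟩
  · rfl
  · have hj : Encodable.encode (v, w) = j := Encodable.mem_decode₂.1 hd
    have : v.length ≤ j := by
      rw [← hj]
      exact (Encodable.length_le_encode v).trans (Nat.left_le_pair _ _)
    simp [h v this]

lemma computable_graphName {α : Type*} [Primcodable α] {φ : α → List Bool → List Bool}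
    (hφ : Computable₂ φ) : Computable₂ fun a j => graphName (φ a) j := by
  have h1 : Computable fun x : α × ℕ => Encodable.decode₂ (List Bool × List Bool) x.2 :=
    Primrec.decode₂.to_comp.comp Computable.snd
  have h2 : Computable₂ fun (x : α × ℕ) (vw : List Bool × List Bool) =>
      decide (φ x.1 vw.1 = vw.2) :=
    computable_decide_eq (hφ.comp (Computable.fst.comp Computable.fst)
      (Computable.fst.comp Computable.snd)) (Computable.snd.comp Computable.snd)
  exact Computable.option_getD (Computable.option_map h1 h2) (Computable.const false)

lemma monoWord_map_range {B : List Bool → ℕ → Bool}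
    (hB : ∀ v v' t, v <+: v' → t < v.length → B v t = B v' t) :
    MonoWord fun v => (List.range v.length).map (B v) := by
  rintro v _ ⟨u, rfl⟩
  simp only [List.length_append, List.range_add, List.map_append]
  refine ⟨_, congrArg₂ (· ++ ·) (List.map_congr_left fun t ht => ?_) rfl⟩
  exact hB _ _ t ⟨u, rfl⟩ (List.mem_range.1 ht)

lemma produces_map_range {B : List Bool → ℕ → Bool}
    (hB : ∀ v v' t, v <+: v' → t < v.length → B v t = B v' t) (p : Cantor) :
    Produces (fun v => (List.range v.length).map (B v)) p fun t => B (p.pre (t + 1)) t := by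
  refine fun m => ⟨m, ?_⟩
  simp only [Cantor.pre_length]
  refine Eq.subst (motive := fun l => _ <+: l) ?_ (List.prefix_refl _)
  refine List.map_congr_left fun t ht => hB _ _ t (p.pre_prefix (List.mem_range.1 ht)) ?_
  simp [Cantor.pre_length]

/-- A function that sends `r` to the name of a word function is computable, if the `t`-th bit that
this word function writes on `v` is computed from `v` and the prefix of `r` of length `t`. -/
lemma computableFun_graphName {B : List Bool → List Bool → ℕ → Bool}
    (hB : Computable fun x : List Bool × List Bool × ℕ => B x.1 x.2.1 x.2.2) :
    ComputableFun fun r => Part.some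
      (graphName fun v => (List.range v.length).map fun t => B (r.pre t) v t) := by
  let ψ : List Bool → List Bool → List Bool := fun w v =>
    (List.range v.length).map fun t => B (w.take t) v t
  have hψ : Computable₂ ψ := by
    refine computable_map_range (Computable.list_length.comp Computable.snd) ?_
    exact hB.comp (Computable.pair
      (Primrec.list_take.to_comp.comp Computable.snd (Computable.fst.comp Computable.fst))
      (Computable.pair (Computable.snd.comp Computable.fst) Computable.snd))
  have hpre : ∀ (w w' : List Bool) (j : ℕ), w <+: w' → j < w.length →
      graphName (ψ w) j = graphName (ψ w') j := by
    rintro w _ j ⟨u, rfl⟩ hj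
    refine graphName_congr fun v hv => List.map_congr_left fun t ht => ?_
    have := List.mem_range.1 ht
    rw [List.take_append_of_le_length (by omega)]
  refine ⟨fun w => (List.range w.length).map (graphName (ψ w)),
    computable_map_range Computable.list_length (computable_graphName hψ),
    monoWord_map_range hpre, ?_⟩
  rintro r q hq
  rw [Part.mem_some_iff] at hq
  convert produces_map_range hpre r using 1
  rw [hq]
  funext j
  refine graphName_congr fun v hv => List.map_congr_left fun t ht => ?_
  have := List.mem_range.1 ht
  rw [r.take_pre (by omega)]

/-! ### Unbounded search along an input -/

/-- The part of a list of partial bits before the first undefined one. -/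
def definedPart (l : List (Option Bool)) : List Bool :=
  (l.takeWhile Option.isSome).map fun o => o.getD false

lemma definedPart_prefix {l l' : List (Option Bool)}
    (h : ∀ (j : ℕ) (b : Bool), l[j]? = some (some b) → l'[j]? = some (some b)) :
    definedPart l <+: definedPart l' := by
  induction l generalizing l' with
  | nil => simp [definedPart]
  | cons o l ih =>
    cases o with
    | none => simp [definedPart]
    | some b =>
      cases l' with
      | nil => simpa using h 0 b
      | cons o' l' =>
        obtain rfl : o' = some b := by simpa using h 0 b
        have := ih (l' := l') fun j b hj => by simpa using h (j + 1) b (by simpa using hj)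
        simpa [definedPart] using this

lemma definedPart_map_some (l : List Bool) : definedPart (l.map some) = l := by
  induction l with
  | nil => rfl
  | cons b l ih => simpa [definedPart] using ih

lemma idxOf_true_map_range {P : ℕ → Bool} {m n : ℕ} (hmn : m < n) (hm : P m = true)
    (hlt : ∀ i < m, P i = false) : ((List.range n).map P).idxOf true = m := by
  obtain ⟨k, rfl⟩ := Nat.exists_eq_add_of_lt hmn
  rw [show m + k + 1 = m + (k + 1) by ring, List.range_add, List.map_append,
    List.idxOf_append_of_notMem]
  · simp [List.range_succ_eq_map, hm]
  · simpa using hlt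

/-- A machine can search, for every `k`, for the first `t` such that the decidable test `T k w t`
succeeds on the prefix `w` of length `t` of its input, and write (a name of) the sequence of the
values `val t` so found. -/
lemma exists_search_machine {T : ℕ → List Bool → ℕ → Bool} {val : ℕ → ℕ}
    (hT : Computable fun x : ℕ × List Bool × ℕ => T x.1 x.2.1 x.2.2) (hval : Computable val) :
    ∃ φ, Computable φ ∧ MonoWord φ ∧ ∀ r : Cantor, (∀ k, ∃ t, T k (r.pre t) t = true) →
      ∃ q s, Produces φ r q ∧ EncodesSeq q s ∧
        ∀ k, ∃ t, T k (r.pre t) t = true ∧ s k = val t := by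
  -- the first success of the test for `k` on `w`, or `w.length` if there is none
  let S : List Bool → ℕ → ℕ := fun w k =>
    ((List.range w.length).map fun t => T k (w.take t) t).idxOf true
  let g : List Bool → ℕ → Option Bool := fun w j =>
    bif decide (S w j.unpair.1 < w.length) then
      some (decide (val (S w j.unpair.1) = j.unpair.2)) else none
  have hS : Computable₂ S := by
    refine (Primrec.list_idxOf (α := Bool)).to_comp.comp (Computable.const true)
      (computable_map_range (Computable.list_length.comp Computable.fst) ?_)
    exact hT.comp (Computable.pair (Computable.snd.comp Computable.fst)
      (Computable.pair (Primrec.list_take.to_comp.comp Computable.snd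
        (Computable.fst.comp Computable.fst)) Computable.snd))
  have hS' : Computable fun x : List Bool × ℕ => S x.1 x.2.unpair.1 :=
    hS.comp Computable.fst (Computable.fst.comp (Computable.unpair.comp Computable.snd))
  have hg : Computable₂ g :=
    Computable.cond
      (computable_decide_lt hS' (Computable.list_length.comp Computable.fst))
      (Computable.option_some.comp (computable_decide_eq (hval.comp hS')
        (Computable.snd.comp (Computable.unpair.comp Computable.snd))))
      (Computable.const none)
  have hφ : Computable fun w => definedPart ((List.range w.length).map (g w)) := by
    have h : Computable definedPart :=
      (Primrec.list_map (Primrec.list_takeWhile Primrec.option_isSome)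
        (Primrec.option_getD.comp₂ Primrec₂.right (Primrec₂.const false))).to_comp
    exact h.comp (computable_map_range Computable.list_length hg)
  have hSlt : ∀ w w' k, w <+: w' → S w k < w.length → S w' k = S w k := by
    rintro w _ k ⟨u, rfl⟩ h
    have e : ((List.range (w ++ u).length).map fun t => T k ((w ++ u).take t) t) =
        ((List.range w.length).map fun t => T k (w.take t) t) ++
          (List.range u.length).map fun t => T k ((w ++ u).take (w.length + t)) (w.length + t) := by
      simp only [List.length_append, List.range_add, List.map_append, List.map_map]
      refine congrArg₂ (· ++ ·) (List.map_congr_left fun t ht => ?_) rfl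
      rw [List.take_append_of_le_length (List.mem_range.1 ht).le]
    simp only [S] at h ⊢
    rw [e, List.idxOf_append_of_mem]
    exact List.idxOf_lt_length_iff.1 (by simpa using h)
  have hgmono : ∀ w w' j b, w <+: w' → g w j = some b → g w' j = some b := by
    intro w w' j b hw h
    simp only [g, Bool.cond_decide] at h ⊢
    split_ifs at h with h1
    rw [hSlt _ _ _ hw h1, if_pos (h1.trans_le hw.length_le), h]
  refine ⟨_, hφ, ?_, ?_⟩
  · intro w w' hw
    refine definedPart_prefix fun j b h => ?_
    simp only [List.getElem?_map, Option.map_eq_some_iff] at h ⊢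
    obtain ⟨i, hi, h⟩ := h
    obtain ⟨h1, h2⟩ := List.getElem?_eq_some_iff.1 hi
    obtain rfl : j = i := by simpa using h2
    have hj : j < w.length := by simpa using h1
    exact ⟨j, by simp [hj.trans_le hw.length_le], hgmono _ _ _ _ hw h⟩
  · intro r hr
    have hfind : ∀ k n, Nat.find (hr k) < n → S (r.pre n) k = Nat.find (hr k) := by
      intro k n hn
      have e : ((List.range (r.pre n).length).map fun t => T k ((r.pre n).take t) t) =
          (List.range n).map fun t => T k (r.pre t) t := by
        rw [Cantor.pre_length]
        exact List.map_congr_left fun t ht => by rw [r.take_pre (List.mem_range.1 ht).le]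
      simp only [S]
      rw [e]
      exact idxOf_true_map_range hn (Nat.find_spec (hr k)) fun t ht => by
        simpa using Nat.find_min (hr k) ht
    refine ⟨fun j => decide (val (Nat.find (hr j.unpair.1)) = j.unpair.2),
      fun k => val (Nat.find (hr k)), ?_, fun k n => by simp,
      fun k => ⟨_, Nat.find_spec (hr k), rfl⟩⟩
    intro m
    have : ∃ n, m ≤ n ∧ ∀ j < m, Nat.find (hr j.unpair.1) < n := by
      refine ⟨m + ((Finset.range m).sup fun j => Nat.find (hr j.unpair.1)) + 1, by omega,
        fun j hj => ?_⟩
      have := Finset.le_sup (f := fun j => Nat.find (hr j.unpair.1)) (Finset.mem_range.2 hj)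
      omega
    obtain ⟨n, hmn, hn⟩ := this
    refine ⟨n, ?_⟩
    rw [← definedPart_map_some (Cantor.pre _ m)]
    refine definedPart_prefix fun j b h => ?_
    have hj : j < m := by
      by_contra hj
      rw [List.getElem?_eq_none (by simpa [Cantor.pre] using hj)] at h
      cases h
    have hb : decide (val (Nat.find (hr j.unpair.1)) = j.unpair.2) = b := by
      simpa [Cantor.pre, hj] using h
    simp [g, Cantor.pre_length, hj.trans_le hmn, hfind _ _ (hn j hj), hn j hj, hb]

/-! ### Open sets listed by sequences of balls -/

open ComputableMetricSpace (point)

/-- The pair `(n, k)` stands for the ball of radius `2 ^ (-k)` around the `n`-th point of the dense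
sequence. -/
def ratBall (Y : Type v) [ComputableMetricSpace Y] (c : ℕ × ℕ) : Set Y :=
  {y | dist (point c.1 : Y) y < 1 / 2 ^ c.2}

/-- The approximate distance `a (i, n, l)` guarantees that the closed ball of radius `2 ^ (-m)`
around the `i`-th point of the dense sequence is contained in the ball `c = (n, k)`:
`(a (i, n, l) + 1) / 2 ^ l + 1 / 2 ^ m < 1 / 2 ^ k`. -/
def inside (a : ℕ × ℕ × ℕ → ℕ) (c : ℕ × ℕ) (m i l : ℕ) : Bool :=
  decide ((a (i, c.1, l) + 1) * 2 ^ (m + c.2) + 2 ^ (l + c.2) < 2 ^ (l + m))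

/-- The approximate distance at precision `2 ^ (-l)` guarantees that the balls `c` and `c'` are
disjoint: `1 / 2 ^ c.2 + 1 / 2 ^ c'.2 + 1 / 2 ^ l < a (c.1, c'.1, l) / 2 ^ l`. -/
def apart (a : ℕ × ℕ × ℕ → ℕ) (c c' : ℕ × ℕ) (l : ℕ) : Bool :=
  decide ((2 ^ c.2 + 2 ^ c'.2) * 2 ^ l + 2 ^ (c.2 + c'.2) <
    a (c.1, c'.1, l) * 2 ^ (c.2 + c'.2))

/-- `a` computes the distances of the dense sequence of `Y`, as in `ComputableMetricSpace`. -/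
def ApproxDist (Y : Type v) [ComputableMetricSpace Y] (a : ℕ × ℕ × ℕ → ℕ) : Prop :=
  ∀ i j k, |dist (point i : Y) (point j) - (a (i, j, k) : ℝ) / 2 ^ k| ≤ 1 / 2 ^ k

section Balls

variable {Y : Type v} [ComputableMetricSpace Y] {a : ℕ × ℕ × ℕ → ℕ}

lemma inside_iff {c : ℕ × ℕ} {m i l : ℕ} : inside a c m i l = true ↔
    ((a (i, c.1, l) : ℝ) + 1) / 2 ^ l + 1 / 2 ^ m < 1 / 2 ^ c.2 := by
  rw [inside, decide_eq_true_eq, ← Nat.cast_lt (α := ℝ)]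
  push_cast
  rw [← sub_pos, ← sub_pos (b := _ + 1 / 2 ^ m)]
  have h : (1 : ℝ) / 2 ^ c.2 - (((a (i, c.1, l) : ℝ) + 1) / 2 ^ l + 1 / 2 ^ m) =
      (2 ^ (l + m) - ((a (i, c.1, l) + 1) * 2 ^ (m + c.2) + 2 ^ (l + c.2))) /
        (2 ^ l * 2 ^ m * 2 ^ c.2) := by
    field_simp
    ring
  rw [h, div_pos_iff_of_pos_right (by positivity)]

lemma apart_iff {c c' : ℕ × ℕ} {l : ℕ} : apart a c c' l = true ↔
    (1 : ℝ) / 2 ^ c.2 + 1 / 2 ^ c'.2 + 1 / 2 ^ l < a (c.1, c'.1, l) / 2 ^ l := by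
  rw [apart, decide_eq_true_eq, ← Nat.cast_lt (α := ℝ)]
  push_cast
  rw [← sub_pos, ← sub_pos (b := _ + 1 / 2 ^ l)]
  have h : (a (c.1, c'.1, l) : ℝ) / 2 ^ l - (1 / 2 ^ c.2 + 1 / 2 ^ c'.2 + 1 / 2 ^ l) =
      (a (c.1, c'.1, l) * 2 ^ (c.2 + c'.2) -
        ((2 ^ c.2 + 2 ^ c'.2) * 2 ^ l + 2 ^ (c.2 + c'.2))) / (2 ^ l * 2 ^ c.2 * 2 ^ c'.2) := by
    field_simp
    ring
  rw [h, div_pos_iff_of_pos_right (by positivity)]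

lemma not_mem_ratBall_of_apart (ha : ApproxDist Y a) {c c' : ℕ × ℕ} {l : ℕ}
    (h : apart a c c' l = true) {y : Y} (hy : y ∈ ratBall Y c) : y ∉ ratBall Y c' := by
  intro hy'
  have h1 := apart_iff.1 h
  have h2 := (abs_le.1 (ha c.1 c'.1 l)).1
  have h3 := dist_triangle_right (point c.1 : Y) (point c'.1) y
  simp only [ratBall, Set.mem_ofPred_eq] at hy hy'
  linarith

lemma exists_one_div_two_pow_lt {δ : ℝ} (hδ : 0 < δ) : ∃ k : ℕ, (1 : ℝ) / 2 ^ k < δ := by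
  obtain ⟨k, hk⟩ := exists_pow_lt_of_lt_one hδ (show (1 / 2 : ℝ) < 1 by norm_num)
  exact ⟨k, by rwa [one_div, inv_pow, ← one_div] at hk⟩

lemma exists_mem_ratBall (y : Y) (k : ℕ) : ∃ n, y ∈ ratBall Y (n, k) := by
  obtain ⟨n, hn⟩ := (ComputableMetricSpace.dense_point (X := Y)).exists_dist_lt y
    (show (0 : ℝ) < 1 / 2 ^ k by positivity)
  exact ⟨n, by rwa [dist_comm] at hn⟩

lemma exists_apart (ha : ApproxDist Y a) {c : ℕ × ℕ} {y : Y}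
    (h : 1 / 2 ^ c.2 < dist (point c.1 : Y) y) :
    ∃ c' l, y ∈ ratBall Y c' ∧ apart a c c' l = true := by
  obtain ⟨k, hk⟩ := exists_one_div_two_pow_lt
    (show 0 < (dist (point c.1 : Y) y - 1 / 2 ^ c.2) / 4 by linarith)
  obtain ⟨n, hn⟩ := exists_mem_ratBall y k
  refine ⟨(n, k), k, hn, apart_iff.2 ?_⟩
  have h2 := (abs_le.1 (ha c.1 n k)).2
  have h3 := dist_triangle (point c.1 : Y) (point n) y
  simp only [ratBall, Set.mem_ofPred_eq] at hn ⊢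
  linarith

/-- The union of the balls listed by `e`. -/
def listedUnion (Y : Type v) [ComputableMetricSpace Y] (e : ℕ → ℕ × ℕ) : Set Y :=
  {y | ∃ j, y ∈ ratBall Y (e j)}

/-- The `t`-th bit of the search for a proof that the point with Cauchy name beginning with `v` is in
the union of the balls listed by `e`. The number `t` codes `(m, i)`, a ball number `j` and a
precision `l`; the bit is set if the name has `i` as its `m`-th entry and this puts the point inside
the `j`-th ball. -/
def unionBit (a : ℕ × ℕ × ℕ → ℕ) (e : ℕ → ℕ × ℕ) (v : List Bool) (t : ℕ) : Bool :=
  decide (v[t.unpair.1]? = some true) && inside a (e t.unpair.2.unpair.1) t.unpair.1.unpair.1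
    t.unpair.1.unpair.2 t.unpair.2.unpair.2

/-- A machine that semidecides, on Cauchy names, membership in the union of the balls listed by
`e`. -/
def unionWord (a : ℕ × ℕ × ℕ → ℕ) (e : ℕ → ℕ × ℕ) (v : List Bool) : List Bool :=
  (List.range v.length).map (unionBit a e v)

/-- The name of the union of the balls listed by `e` as an open set. -/
def unionName (a : ℕ × ℕ × ℕ → ℕ) (e : ℕ → ℕ × ℕ) : Cantor := graphName (unionWord a e)

lemma unionBit_mono {e : ℕ → ℕ × ℕ} (v v' : List Bool) (t : ℕ) (h : v <+: v')
    (ht : t < v.length) : unionBit a e v t = unionBit a e v' t := by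
  obtain ⟨u, rfl⟩ := h
  unfold unionBit
  rw [List.getElem?_append_left ((Nat.unpair_left_le t).trans_lt ht)]

lemma unionBit_pre_iff {e : ℕ → ℕ × ℕ} {p : Cantor} {t : ℕ} :
    unionBit a e (p.pre (t + 1)) t = true ↔ p t.unpair.1 = true ∧
      inside a (e t.unpair.2.unpair.1) t.unpair.1.unpair.1
        t.unpair.1.unpair.2 t.unpair.2.unpair.2 = true := by
  have := Nat.unpair_left_le t
  simp [unionBit, Cantor.getElem?_pre_eq_some_true, this]

lemma exists_unionBit_iff (ha : ApproxDist Y a) {e : ℕ → ℕ × ℕ} {p : Cantor} {y : Y}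
    (hp : (cauchyRep Y).names p y) :
    (∃ t, unionBit a e (p.pre (t + 1)) t = true) ↔ y ∈ listedUnion Y e := by
  obtain ⟨s, hs, hy⟩ := hp
  simp only [unionBit_pre_iff]
  constructor
  · rintro ⟨t, h1, h2⟩
    refine ⟨t.unpair.2.unpair.1, ?_⟩
    have h3 : s t.unpair.1.unpair.1 = t.unpair.1.unpair.2 := (hs _ _).1 (by simpa using h1)
    have h4 := hy t.unpair.1.unpair.1
    rw [h3] at h4
    rw [inside_iff] at h2
    have h5 := (abs_le.1 (ha t.unpair.1.unpair.2 (e t.unpair.2.unpair.1).1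
      t.unpair.2.unpair.2)).2
    have h6 := dist_triangle_left (point (e t.unpair.2.unpair.1).1 : Y) y
      (point t.unpair.1.unpair.2)
    simp only [ratBall, Set.mem_ofPred_eq]
    rw [add_div] at h2
    linarith
  · rintro ⟨j, hj⟩
    simp only [ratBall, Set.mem_ofPred_eq] at hj
    obtain ⟨m, hm⟩ := exists_one_div_two_pow_lt
      (show 0 < (1 / 2 ^ (e j).2 - dist (point (e j).1 : Y) y) / 4 by linarith)
    refine ⟨Nat.pair (Nat.pair m (s m)) (Nat.pair j m), ?_⟩
    simp only [Nat.unpair_pair, (hs m (s m)).2 rfl, true_and, inside_iff]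
    have h5 := (abs_le.1 (ha (s m) (e j).1 m)).1
    have h6 := dist_triangle_right (point (s m) : Y) (point (e j).1) y
    have h7 := hy m
    rw [add_div]
    linarith

lemma monoWord_unionWord (e : ℕ → ℕ × ℕ) : MonoWord (unionWord a e) :=
  monoWord_map_range unionBit_mono

lemma namesFun_unionName (ha : ApproxDist Y a) (e : ℕ → ℕ × ℕ) :
    NamesFun (cauchyRep Y) sierpinskiRep (unionName a e) (fun y => y ∈ listedUnion Y e) :=
  ⟨unionWord a e, monoWord_unionWord e, encodesWord_graphName _, fun p _ hp =>
    ⟨_, produces_map_range unionBit_mono p, (exists_unionBit_iff ha hp).symm⟩⟩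

lemma unionName_pre_congr {e e' : ℕ → ℕ × ℕ} {L : ℕ} (h : ∀ j < L, e j = e' j) :
    (unionName a e).pre L = (unionName a e').pre L := by
  refine List.map_congr_left fun j hj => graphName_congr fun v hv => List.map_congr_left
    fun t ht => ?_
  have h1 := List.mem_range.1 hj
  have h2 := List.mem_range.1 ht
  have h3 := (Nat.unpair_left_le t.unpair.2).trans (Nat.unpair_right_le t)
  rw [unionBit, unionBit, h _ (by omega)]

/-- The initial segment of `unionName a e` that is determined by the first balls `w` of `e`. -/
def unionPre (a : ℕ × ℕ × ℕ → ℕ) (w : List (ℕ × ℕ)) : List Bool :=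
  (unionName a fun j => w.getD j (0, 0)).pre w.length

lemma unionPre_eq {e : ℕ → ℕ × ℕ} {w : List (ℕ × ℕ)} (h : ∀ j < w.length, w[j]? = some (e j)) :
    unionPre a w = (unionName a e).pre w.length :=
  unionName_pre_congr fun j hj => by simp [List.getD_eq_getElem?_getD, h j hj]

lemma primrec_two_pow : Primrec fun n : ℕ => 2 ^ n := by
  refine (Primrec.nat_rec₁ 1 (f := fun _ x => 2 * x)
    (Primrec.nat_double.comp Primrec.snd).to₂).of_eq fun n => ?_
  induction n with
  | zero => rfl
  | succ n ih => simp only [ih, pow_succ]; ring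

lemma computable_add {α : Type*} [Primcodable α] {f g : α → ℕ} (hf : Computable f)
    (hg : Computable g) : Computable fun x => f x + g x := Primrec.nat_add.to_comp.comp hf hg

lemma computable_mul {α : Type*} [Primcodable α] {f g : α → ℕ} (hf : Computable f)
    (hg : Computable g) : Computable fun x => f x * g x := Primrec.nat_mul.to_comp.comp hf hg

lemma computable_two_pow {α : Type*} [Primcodable α] {f : α → ℕ} (hf : Computable f) :
    Computable fun x => 2 ^ f x := primrec_two_pow.to_comp.comp hf

lemma computable_inside (ha : Computable a) {α : Type*} [Primcodable α] {c : α → ℕ × ℕ}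
    {m i l : α → ℕ} (hc : Computable c) (hm : Computable m) (hi : Computable i)
    (hl : Computable l) : Computable fun x => inside a (c x) (m x) (i x) (l x) := by
  have hc1 := Computable.fst.comp hc
  have hc2 := Computable.snd.comp hc
  exact computable_decide_lt
    (computable_add (computable_mul
      (computable_add (ha.comp (hi.pair (hc1.pair hl))) (Computable.const 1))
      (computable_two_pow (computable_add hm hc2)))
      (computable_two_pow (computable_add hl hc2)))
    (computable_two_pow (computable_add hl hm))

lemma computable_apart (ha : Computable a) {α : Type*} [Primcodable α] {c c' : α → ℕ × ℕ}
    {l : α → ℕ} (hc : Computable c) (hc' : Computable c') (hl : Computable l) :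
    Computable fun x => apart a (c x) (c' x) (l x) := by
  have hc2 := Computable.snd.comp hc
  have hc2' := Computable.snd.comp hc'
  exact computable_decide_lt
    (computable_add (computable_mul
      (computable_add (computable_two_pow hc2) (computable_two_pow hc2'))
      (computable_two_pow hl)) (computable_two_pow (computable_add hc2 hc2')))
    (computable_mul (ha.comp ((Computable.fst.comp hc).pair ((Computable.fst.comp hc').pair hl)))
      (computable_two_pow (computable_add hc2 hc2')))

lemma computable_unionPre (ha : Computable a) : Computable (unionPre a) := by
  refine computable_map_range Computable.list_length (computable_graphName
    (φ := fun (w : List (ℕ × ℕ)) => unionWord a fun j => w.getD j (0, 0)) ?_)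
  refine computable_map_range (Computable.list_length.comp Computable.snd) ?_
  have ht : Computable fun x : (List (ℕ × ℕ) × List Bool) × ℕ => x.2.unpair :=
    Computable.unpair.comp Computable.snd
  have ht1 := Computable.unpair.comp (Computable.fst.comp ht)
  have ht2 := Computable.unpair.comp (Computable.snd.comp ht)
  refine computable_and (computable_decide_eq (Computable.list_getElem?.comp
    (Computable.snd.comp Computable.fst) (Computable.fst.comp ht)) (Computable.const _)) ?_
  refine computable_inside ha (Computable₂.comp (f := fun (l : List (ℕ × ℕ)) n => l.getD n (0, 0))
      (Primrec.list_getD _).to_comp (Computable.fst.comp Computable.fst) (Computable.fst.comp ht2))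
    (Computable.fst.comp ht1) (Computable.snd.comp ht1) (Computable.snd.comp ht2)

end Balls


/-! ### Running a name of a `Δ⁰₂`-measurable function -/

/-- The witness of an accepting run consists of the word written by the name of `f⁻¹` on a prefix of
the name of an open set, the length of a prefix of the name of an index `i`, the word written on
that prefix, the length of a prefix of the name of `x`, the word written on it, and the position of
a set bit in this last word. -/
abbrev RunWitness : Type := List Bool × ℕ × List Bool × ℕ × List Bool × ℕ

/-- `s` witnesses that, for the machine encoded by `pw` and the point named by `qw`, the prefix `c`
of a name of an open set `U` suffices to accept that the point is in the `i`-th of the open sets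
with intersection `f⁻¹ U`. -/
def accepts (pw qw c : List Bool) (i : ℕ) (s : RunWitness) : Bool :=
  decide (pw[Encodable.encode (c, s.1)]? = some true) &&
  (decide (s.1[Encodable.encode ((List.range s.2.1).map fun t => decide (t = i), s.2.2.1)]? =
    some true) &&
  (decide (s.2.2.2.1 ≤ qw.length) &&
  (decide (s.2.2.1[2 * Encodable.encode (qw.take s.2.2.2.1, s.2.2.2.2.1) + 1]? = some true) &&
  decide (s.2.2.2.2.1[s.2.2.2.2.2]? = some true))))

section Run

variable {X : Type u} {ρX : Representation X} {Y : Type v} [ComputableMetricSpace Y]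
  {a : ℕ × ℕ × ℕ → ℕ} {f : X → Y} {p q : Cantor} {x : X}

/-- The name of `f` turns the name of `listedUnion Y e` into that of a sequence of open sets with
intersection `f ⁻¹' listedUnion Y e`. With `V i` for membership of `x` in the `i`-th of them, `V i`
is equivalent to the existence of a finite accepting run, which may be chosen to use arbitrarily
long prefixes of the name of `listedUnion Y e`. -/
lemma exists_inter_iff_accepts (ha : ApproxDist Y a)
    (hf : NamesDelta2Fun ρX (cauchyRep Y) p f) (hq : ρX.names q x) (e : ℕ → ℕ × ℕ) :
    ∃ V : ℕ → Prop, (f x ∈ listedUnion Y e ↔ ∀ i, V i) ∧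
      (∀ i L s n, accepts (p.pre n) (q.pre n) ((unionName a e).pre L) i s = true → V i) ∧
      ∀ i N, V i → ∃ L s n, N ≤ L ∧
        accepts (p.pre n) (q.pre n) ((unionName a e).pre L) i s = true := by
  obtain ⟨g, ⟨Φ, hΦ, hpΦ, hg⟩, hgf⟩ := hf
  let U : OpenSet (cauchyRep Y) := ⟨listedUnion Y e, unionName a e, namesFun_unionName ha e⟩
  obtain ⟨d, hΦd, σ, ⟨θ, hθ, hdθ, hσ⟩, -, hD⟩ :=
    hg (unionName a e) U (namesFun_unionName ha e)
  rw [hgf U] at hD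
  have hz : ∀ i, natRep.names (fun t => decide (t = i)) i := fun i => by simp [natRep]
  refine ⟨fun i => x ∈ (σ.1 i).2.1, ?_, ?_, ?_⟩
  · have := Set.ext_iff.1 hD x
    simpa only [Set.mem_preimage, Set.mem_iInter] using this
  · intro i L s n h
    obtain ⟨c', j, z, m, o', k⟩ := s
    simp only [accepts, Bool.and_eq_true, decide_eq_true_eq] at h
    obtain ⟨h1, h2, -, h3, h4⟩ := h
    obtain ⟨c, hθc, -, τ, hτ, hcτ, hx⟩ := hσ _ i (hz i)
    obtain ⟨o, hτo, ho⟩ := hx q x hq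
    refine ho.2 ⟨k, ?_⟩
    have e1 := (hpΦ _ _).1 (Cantor.getElem?_pre_eq_some_true.1 h1).2
    rw [hΦd.eq_pre hΦ] at e1
    rw [← e1] at h2
    have e2 := (hdθ _ _).1 (Cantor.getElem?_pre_eq_some_true.1 h2).2
    have e2' := hθc.eq_pre hθ j
    rw [Cantor.pre, e2] at e2'
    rw [e2'] at h3
    have e3 := (hcτ _ _).1 (Cantor.getElem?_pre_eq_some_true.1 h3).2
    have e4 := q.eq_pre_of_prefix n _ (List.take_prefix m _)
    rw [e4, hτo.eq_pre hτ] at e3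
    rw [← e3] at h4
    exact (Cantor.getElem?_pre_eq_some_true.1 h4).2
  · intro i N hV
    obtain ⟨c, hθc, -, τ, hτ, hcτ, hx⟩ := hσ _ i (hz i)
    obtain ⟨o, hτo, ho⟩ := hx q x hq
    obtain ⟨k, hk⟩ := ho.1 hV
    have key : ∀ {w : List Bool} {b : Cantor} {t : ℕ}, b.pre (t + 1) <+: w → b t = true →
        w[t]? = some true := by
      rintro _ b t ⟨u, rfl⟩ hb
      rw [List.getElem?_append_left (by simp [Cantor.pre_length])]
      exact Cantor.getElem?_pre_eq_some_true.2 ⟨Nat.lt_succ_self t, hb⟩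
    -- the witness is found backwards, from the bit `k` that accepts `x` to the name of `f`
    obtain ⟨m, hm⟩ := hτo (k + 1)
    have h4 := key hm hk
    have h3 : c (2 * Encodable.encode (q.pre m, τ (q.pre m)) + 1) = true := (hcτ _ _).2 rfl
    obtain ⟨j, hj⟩ := hθc (2 * Encodable.encode (q.pre m, τ (q.pre m)) + 1 + 1)
    have h3' := key hj h3
    have h2 := (hdθ (Cantor.pre (fun t => decide (t = i)) j) _).2 rfl
    obtain ⟨L, hNL, hL⟩ := hΦd.exists_ge hΦ _ N
    have h2' := key hL h2
    have h1 := (hpΦ ((unionName a e).pre L) _).2 rfl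
    refine ⟨L, (Φ ((unionName a e).pre L), j, θ (Cantor.pre (fun t => decide (t = i)) j), m,
      τ (q.pre m), k), max m (Encodable.encode ((unionName a e).pre L,
        Φ ((unionName a e).pre L)) + 1), hNL, ?_⟩
    simp only [accepts, Bool.and_eq_true, decide_eq_true_eq]
    refine ⟨Cantor.getElem?_pre_eq_some_true.2 ⟨by omega, h1⟩, h2',
      by simp [Cantor.pre_length], ?_, h4⟩
    rw [q.take_pre (by omega)]
    exact h3'

end Run

lemma accepts_mono {pw pw' qw qw' c : List Bool} {i : ℕ} {s : RunWitness} (hp : pw <+: pw')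
    (hq : qw <+: qw') (h : accepts pw qw c i s = true) : accepts pw' qw' c i s = true := by
  obtain ⟨u, rfl⟩ := hp
  obtain ⟨v, rfl⟩ := hq
  simp only [accepts, Bool.and_eq_true, decide_eq_true_eq] at h ⊢
  obtain ⟨h1, h2, h3, h4, h5⟩ := h
  refine ⟨?_, h2, h3.trans (by simp), ?_, h5⟩
  · rw [List.getElem?_append_left, h1]
    exact (List.getElem?_eq_some_iff.1 h1).1
  · rwa [List.take_append_of_le_length h3]

lemma computable_accepts {α : Type*} [Primcodable α] {pw qw c : α → List Bool} {i : α → ℕ}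
    {s : α → RunWitness} (hp : Computable pw) (hq : Computable qw) (hc : Computable c)
    (hi : Computable i) (hs : Computable s) :
    Computable fun x => accepts (pw x) (qw x) (c x) (i x) (s x) := by
  have s1 := Computable.fst.comp hs
  have t1 := Computable.snd.comp hs
  have s2 := Computable.fst.comp t1
  have t2 := Computable.snd.comp t1
  have s3 := Computable.fst.comp t2
  have t3 := Computable.snd.comp t2
  have s4 := Computable.fst.comp t3
  have t4 := Computable.snd.comp t3
  have s5 := Computable.fst.comp t4
  have s6 := Computable.snd.comp t4
  refine computable_and (computable_decide_eq (Computable.list_getElem?.comp hp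
    (Computable.encode.comp (hc.pair s1))) (Computable.const _)) ?_
  refine computable_and (computable_decide_eq (Computable.list_getElem?.comp s1
    (Computable.encode.comp (Computable.pair (computable_map_range s2
      (computable_decide_eq Computable.snd (hi.comp Computable.fst)))
      s3))) (Computable.const _)) ?_
  refine computable_and ((Primrec.nat_le.decide.to_comp).comp s4
    (Computable.list_length.comp hq)) ?_
  refine computable_and (computable_decide_eq (Computable.list_getElem?.comp s3
    (Primrec.nat_double_succ.to_comp.comp (Computable.encode.comp
      ((Primrec.list_take.to_comp.comp s4 hq).pair s5)))) (Computable.const _)) ?_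
  exact computable_decide_eq (Computable.list_getElem?.comp s5 s6) (Computable.const _)

/-! ### Rejecting an index and a finite list of balls -/

/-- The pair of an index `i` and a finite list `w` of balls accepts the ball `B` on the prefix `r`
of a name of `(f, x)`: for some `b`, listing `w` and then `b + 1` times the ball `B` suffices to
accept that `x` is in the `i`-th of the open sets with intersection `f⁻¹ U`. -/
def acceptsBall (a : ℕ × ℕ × ℕ → ℕ) (r : List Bool) (iw : ℕ × List (ℕ × ℕ)) (B : ℕ × ℕ)
    (s : ℕ × RunWitness) : Bool :=
  accepts (leftWord r) (rightWord r)
    (unionPre a (iw.2 ++ (List.range (s.1 + 1)).map fun _ => B)) iw.1 s.2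

/-- Evidence that an index and a list of balls are useless: two balls that they accept, with the
witnesses, and a precision at which the balls are seen to be disjoint. -/
abbrev RejectWitness : Type :=
  ℕ × ((ℕ × ℕ) × ℕ × RunWitness) × ((ℕ × ℕ) × ℕ × RunWitness)

/-- `s` witnesses that the index and the list of balls `iw` are useless on the prefix `r` of a name
of `(f, x)`. -/
def rejects (a : ℕ × ℕ × ℕ → ℕ) (r : List Bool) (iw : ℕ × List (ℕ × ℕ))
    (s : RejectWitness) : Bool :=
  apart a s.2.1.1 s.2.2.1 s.1 &&
    (acceptsBall a r iw s.2.1.1 s.2.1.2 && acceptsBall a r iw s.2.2.1 s.2.2.2)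

lemma acceptsBall_mono {a : ℕ × ℕ × ℕ → ℕ} {r : Cantor} {iw : ℕ × List (ℕ × ℕ)} {B : ℕ × ℕ}
    {s : ℕ × RunWitness} {n m : ℕ} (hnm : n ≤ m) (h : acceptsBall a (r.pre n) iw B s = true) :
    acceptsBall a (r.pre m) iw B s = true := by
  refine accepts_mono ?_ ?_ h
  · rw [leftWord_pre, leftWord_pre]
    exact r.left.pre_prefix (Nat.div_le_div_right hnm)
  · rw [rightWord_pre, rightWord_pre]
    exact r.right.pre_prefix (Nat.div_le_div_right hnm)

lemma rejects_mono {a : ℕ × ℕ × ℕ → ℕ} {r : Cantor} {iw : ℕ × List (ℕ × ℕ)}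
    {s : RejectWitness} {n m : ℕ} (hnm : n ≤ m) (h : rejects a (r.pre n) iw s = true) :
    rejects a (r.pre m) iw s = true := by
  simp only [rejects, Bool.and_eq_true] at h ⊢
  exact ⟨h.1, acceptsBall_mono hnm h.2.1, acceptsBall_mono hnm h.2.2⟩

lemma computable_acceptsBall {a : ℕ × ℕ × ℕ → ℕ} (ha : Computable a) {α : Type*} [Primcodable α]
    {r : α → List Bool} {iw : α → ℕ × List (ℕ × ℕ)} {B : α → ℕ × ℕ} {s : α → ℕ × RunWitness}
    (hr : Computable r) (hiw : Computable iw) (hB : Computable B) (hs : Computable s) :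
    Computable fun x => acceptsBall a (r x) (iw x) (B x) (s x) :=
  computable_accepts (computable_leftWord.comp hr) (computable_rightWord.comp hr)
    ((computable_unionPre ha).comp (Computable.list_append.comp (Computable.snd.comp hiw)
      (computable_map_range (Computable.succ.comp (Computable.fst.comp hs))
        (hB.comp Computable.fst))))
    (Computable.fst.comp hiw) (Computable.snd.comp hs)

lemma computable_rejects {a : ℕ × ℕ × ℕ → ℕ} (ha : Computable a) {α : Type*} [Primcodable α]
    {r : α → List Bool} {iw : α → ℕ × List (ℕ × ℕ)} {s : α → RejectWitness}
    (hr : Computable r) (hiw : Computable iw) (hs : Computable s) :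
    Computable fun x => rejects a (r x) (iw x) (s x) := by
  have h1 := Computable.fst.comp (Computable.snd.comp hs)
  have h2 := Computable.snd.comp (Computable.snd.comp hs)
  have c1 := Computable.fst.comp h1
  have c2 := Computable.fst.comp h2
  exact computable_and (computable_apart ha c1 c2 (Computable.fst.comp hs))
    (computable_and (computable_acceptsBall ha hr hiw c1 (Computable.snd.comp h1))
      (computable_acceptsBall ha hr hiw c2 (Computable.snd.comp h2)))

section Reject

variable {X : Type u} {ρX : Representation X} {Y : Type v} [ComputableMetricSpace Y]
  {a : ℕ × ℕ × ℕ → ℕ} {f : X → Y} {r : Cantor} {x : X}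

/-- An index and a list of balls accept every ball that contains `f x`. -/
lemma exists_acceptsBall (ha : ApproxDist Y a) (hf : NamesDelta2Fun ρX (cauchyRep Y) r.left f)
    (hx : ρX.names r.right x) (iw : ℕ × List (ℕ × ℕ)) {B : ℕ × ℕ} (hB : f x ∈ ratBall Y B) :
    ∃ s n, acceptsBall a (r.pre n) iw B s = true := by
  let e : ℕ → ℕ × ℕ := fun j => iw.2.getD j B
  obtain ⟨V, hV, -, hacc⟩ := exists_inter_iff_accepts ha hf hx e
  have hmem : f x ∈ listedUnion Y e := ⟨iw.2.length, by simpa [e] using hB⟩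
  obtain ⟨L, s, n, hL, h⟩ := hacc iw.1 (iw.2.length + 1) (hV.1 hmem iw.1)
  obtain ⟨b, rfl⟩ := Nat.exists_eq_add_of_le hL
  refine ⟨(b, s), 2 * n, ?_⟩
  unfold acceptsBall
  rw [leftWord_pre, rightWord_pre, Nat.mul_div_cancel_left n two_pos,
    unionPre_eq (e := e)]
  · simpa [add_assoc, add_comm 1 b] using h
  · intro j hj
    rcases lt_or_ge j iw.2.length with h' | h'
    · simp [e, List.getElem?_append_left h', h']
    · have : j - iw.2.length < b + 1 := by simp at hj; omega
      simp [e, List.getElem?_append_right h', h', this]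

lemma exists_rejects_of_acceptsBall {iw : ℕ × List (ℕ × ℕ)} {B B' : ℕ × ℕ} {l n n' : ℕ}
    {s s' : ℕ × RunWitness} (h : apart a B B' l = true)
    (hB : acceptsBall a (r.pre n) iw B s = true)
    (hB' : acceptsBall a (r.pre n') iw B' s' = true) :
    ∃ t m, rejects a (r.pre m) iw t = true := by
  refine ⟨(l, (B, s), (B', s')), max n n', ?_⟩
  simp only [rejects, Bool.and_eq_true]
  exact ⟨h, acceptsBall_mono (le_max_left _ _) hB, acceptsBall_mono (le_max_right _ _) hB'⟩

/-- If an index and a list of balls are not rejected, they accept only balls whose closure contains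
`f x`, since a ball around `f x` that is small enough to be apart from `B` is accepted too. -/
lemma dist_le_of_acceptsBall (ha : ApproxDist Y a)
    (hf : NamesDelta2Fun ρX (cauchyRep Y) r.left f) (hx : ρX.names r.right x)
    {iw : ℕ × List (ℕ × ℕ)} (hiw : ¬ ∃ t m, rejects a (r.pre m) iw t = true) {B : ℕ × ℕ}
    {s : ℕ × RunWitness} {n : ℕ} (h : acceptsBall a (r.pre n) iw B s = true) :
    dist (point B.1 : Y) (f x) ≤ 1 / 2 ^ B.2 := by
  by_contra hlt
  obtain ⟨B', l, hB', hl⟩ := exists_apart ha (not_le.1 hlt)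
  obtain ⟨s', n', h'⟩ := exists_acceptsBall ha hf hx iw hB'
  exact hiw (exists_rejects_of_acceptsBall hl h h')

/-- Some index and list of balls are not rejected. Otherwise a diagonal construction lists balls
that avoid `f x` and still make `x` accepted at every index, which would put `f x` into their
union: at stage `i` the list built so far is rejected with index `i`, so that it can be continued by
one of two disjoint accepted balls, one of which does not contain `f x`. -/
lemma exists_not_rejects (ha : ApproxDist Y a) (hf : NamesDelta2Fun ρX (cauchyRep Y) r.left f)
    (hx : ρX.names r.right x) :
    ∃ iw : ℕ × List (ℕ × ℕ), ¬ ∃ t m, rejects a (r.pre m) iw t = true := by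
  by_contra! hall
  have hstep : ∀ (i : ℕ) (w : List (ℕ × ℕ)), ∃ (B : ℕ × ℕ) (s : ℕ × RunWitness) (n : ℕ),
      f x ∉ ratBall Y B ∧ acceptsBall a (r.pre n) (i, w) B s = true := by
    intro i w
    obtain ⟨⟨l, ⟨B, s⟩, ⟨B', s'⟩⟩, m, h⟩ := hall (i, w)
    simp only [rejects, Bool.and_eq_true] at h
    by_cases hB : f x ∈ ratBall Y B
    · exact ⟨B', s', m, not_mem_ratBall_of_apart ha h.1 hB, h.2.2⟩
    · exact ⟨B, s, m, hB, h.2.1⟩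
  choose B s n hB hs using hstep
  let W : ℕ → List (ℕ × ℕ) := fun i => Nat.rec [] (fun i w =>
    w ++ (List.range ((s i w).1 + 1)).map fun _ => B i w) i
  have hW : ∀ i, W (i + 1) =
    W i ++ (List.range ((s i (W i)).1 + 1)).map fun _ => B i (W i) := fun _ => rfl
  have hmono : ∀ i k, W i <+: W (i + k) := by
    intro i k
    induction k with
    | zero => exact List.prefix_refl _
    | succ k ih => exact ih.trans ⟨_, (hW (i + k)).symm⟩
  have hlen : ∀ i, i ≤ (W i).length := by
    intro i
    induction i with
    | zero => exact Nat.zero_le _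
    | succ i ih => simp only [hW, List.length_append, List.length_map, List.length_range]; omega
  have havoid : ∀ i, ∀ c ∈ W i, f x ∉ ratBall Y c := by
    intro i
    induction i with
    | zero => intro c hc; cases hc
    | succ i ih =>
      intro c hc
      rw [hW, List.mem_append] at hc
      rcases hc with hc | hc
      · exact ih c hc
      · obtain ⟨_, -, rfl⟩ := List.mem_map.1 hc
        exact hB _ _
  let e : ℕ → ℕ × ℕ := fun j => (W (j + 1)).getD j (0, 0)
  have he : ∀ i, ∀ j < (W i).length, (W i)[j]? = some (e j) := by
    intro i j hj
    have hj' : j < (W (j + 1)).length := hlen (j + 1)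
    have h1 : (W (j + 1))[j]? = some (e j) := by simp [e, hj']
    rcases le_total i (j + 1) with h | h
    · obtain ⟨k, hk⟩ := Nat.exists_eq_add_of_le h
      obtain ⟨u, hu⟩ := hmono i k
      rw [← h1, hk, ← hu, List.getElem?_append_left hj]
    · obtain ⟨k, rfl⟩ := Nat.exists_eq_add_of_le h
      obtain ⟨u, hu⟩ := hmono (j + 1) k
      rw [← h1, ← hu, List.getElem?_append_left hj']
  obtain ⟨V, hV, hacc, -⟩ := exists_inter_iff_accepts ha hf hx e
  have hmem : f x ∈ listedUnion Y e := by
    refine hV.2 fun i => ?_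
    have h := hs i (W i)
    unfold acceptsBall at h
    simp only [← hW, leftWord_pre, rightWord_pre] at h
    rw [unionPre_eq (he (i + 1))] at h
    exact hacc _ _ _ _ h
  obtain ⟨j, hj⟩ := hmem
  exact havoid (j + 1) (e j) (List.mem_of_getElem? (he (j + 1) j (hlen (j + 1)))) hj

end Reject

/-! ### The reduction -/

/-- The number `j` codes a witness for `T` (together with a number that only serves to make `j` as
large as desired). -/
def codedTest {S : Type*} [Encodable S] (T : S → Bool) (j : ℕ) : Bool :=
  ((Encodable.decode j : Option (S × ℕ)).map fun s => T s.1).getD false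

lemma codedTest_encode {S : Type*} [Encodable S] (T : S → Bool) (s : S) (n : ℕ) :
    codedTest T (Encodable.encode (s, n)) = T s := by
  simp only [codedTest, Encodable.encodek, Option.map_some, Option.getD_some]

lemma le_encode_prod_right {S : Type*} [Encodable S] (s : S) (n : ℕ) :
    n ≤ Encodable.encode (s, n) :=
  Nat.right_le_pair (Encodable.encode s) n

lemma exists_of_codedTest {S : Type*} [Encodable S] {T : S → Bool} {j : ℕ}
    (h : codedTest T j = true) :
    ∃ s n, (Encodable.decode j : Option (S × ℕ)) = some (s, n) ∧ T s = true := by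
  unfold codedTest at h
  rcases hd : (Encodable.decode j : Option (S × ℕ)) with _ | ⟨s, n⟩
  · simp [hd] at h
  · exact ⟨s, n, rfl, by simpa [hd] using h⟩

lemma computable_codedTest {α S : Type*} [Primcodable α] [Primcodable S] {T : α → S → Bool}
    (hT : Computable₂ T) {j : α → ℕ} (hj : Computable j) :
    Computable fun x => codedTest (T x) (j x) :=
  Computable.option_getD (Computable.option_map (Computable.decode.comp hj)
    (hT.comp Computable.fst (Computable.fst.comp Computable.snd))) (Computable.const false)

/-- On names of `m`, the bits of the search for a rejection of the `m`-th pair of an index and a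
list of balls: the number `t` codes `m` and a candidate for a rejection witness. -/
def rejectBit (a : ℕ × ℕ × ℕ → ℕ) (r v : List Bool) (t : ℕ) : Bool :=
  decide (v[t.unpair.1]? = some true) &&
    codedTest (rejects a r (Denumerable.ofNat (ℕ × List (ℕ × ℕ)) t.unpair.1)) t.unpair.2

lemma rejectBit_mono {a : ℕ × ℕ × ℕ → ℕ} {r : Cantor} (v v' : List Bool) (t : ℕ) (h : v <+: v')
    (ht : t < v.length) : rejectBit a (r.pre t) v t = rejectBit a (r.pre t) v' t := by
  obtain ⟨u, rfl⟩ := h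
  unfold rejectBit
  rw [List.getElem?_append_left ((Nat.unpair_left_le t).trans_lt ht)]

/-- The sequence with the bits `rejectBit` names, as a closed set of natural numbers, the set of
codes of pairs of an index and a list of balls that are not rejected. -/
lemma namesFun_rejected (a : ℕ × ℕ × ℕ → ℕ) (r : Cantor) :
    NamesFun natRep sierpinskiRep
      (graphName fun v => (List.range v.length).map fun t => rejectBit a (r.pre t) v t)
      (fun m => m ∈ {m | ¬ ∃ t n,
        rejects a (r.pre n) (Denumerable.ofNat (ℕ × List (ℕ × ℕ)) m) t = true}ᶜ) := by
  refine ⟨_, monoWord_map_range rejectBit_mono, encodesWord_graphName _, fun p m hp =>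
    ⟨_, produces_map_range rejectBit_mono p, ?_⟩⟩
  have hbit : ∀ t, rejectBit a (r.pre t) (p.pre (t + 1)) t = true ↔ t.unpair.1 = m ∧
      codedTest (rejects a (r.pre t) (Denumerable.ofNat (ℕ × List (ℕ × ℕ)) t.unpair.1))
        t.unpair.2 = true := by
    intro t
    have h1 := Nat.unpair_left_le t
    have h2 := hp t.unpair.1
    simp [rejectBit, Cantor.getElem?_pre_eq_some_true, h1, h2]
  simp only [sierpinskiRep, hbit, Set.mem_compl_iff, Set.mem_ofPred_eq, not_not]
  constructor
  · rintro ⟨s, n, h⟩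
    refine ⟨Nat.pair m (Encodable.encode (s, n)), by simp, ?_⟩
    simp only [Nat.unpair_pair, codedTest_encode]
    exact rejects_mono ((le_encode_prod_right s n).trans (Nat.right_le_pair _ _)) h
  · rintro ⟨t, rfl, h⟩
    obtain ⟨s, n, -, h⟩ := exists_of_codedTest h
    exact ⟨s, t, h⟩

lemma computable_rejectBit {a : ℕ × ℕ × ℕ → ℕ} (ha : Computable a) :
    Computable fun x : List Bool × List Bool × ℕ => rejectBit a x.1 x.2.1 x.2.2 := by
  have ht : Computable fun x : List Bool × List Bool × ℕ => x.2.2.unpair :=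
    Computable.unpair.comp (Computable.snd.comp Computable.snd)
  have ht1 := Computable.fst.comp ht
  refine computable_and (computable_decide_eq (Computable.list_getElem?.comp
    (Computable.fst.comp Computable.snd) ht1) (Computable.const _))
    (computable_codedTest ?_ (Computable.snd.comp ht))
  exact computable_rejects ha (Computable.fst.comp Computable.fst)
    ((Computable.ofNat _).comp (ht1.comp Computable.fst)) Computable.snd

/-- The test of the search for an accepted ball of radius `2 ^ (-k)` on the prefix `w` of a name of
`(f, x)` and `m`: a candidate consists of `m`, the centre of the ball and a witness. -/
def evalTest (a : ℕ × ℕ × ℕ → ℕ) (k : ℕ) (w : List Bool) (t : ℕ) : Bool :=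
  codedTest (fun s : ℕ × ℕ × ℕ × RunWitness => decide ((rightWord w)[s.1]? = some true) &&
    acceptsBall a (leftWord w) (Denumerable.ofNat (ℕ × List (ℕ × ℕ)) s.1) (s.2.1, k) s.2.2) t

/-- The centre of the ball found by `evalTest`. -/
def evalCentre (t : ℕ) : ℕ :=
  ((Encodable.decode t : Option ((ℕ × ℕ × ℕ × RunWitness) × ℕ)).map fun s => s.1.2.1).getD 0

lemma computable_evalTest {a : ℕ × ℕ × ℕ → ℕ} (ha : Computable a) :
    Computable fun x : ℕ × List Bool × ℕ => evalTest a x.1 x.2.1 x.2.2 := by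
  refine computable_codedTest ?_ (Computable.snd.comp Computable.snd)
  have hw : Computable fun x : (ℕ × List Bool × ℕ) × ℕ × ℕ × ℕ × RunWitness => x.1.2.1 :=
    Computable.fst.comp (Computable.snd.comp Computable.fst)
  have h1 : Computable fun x : (ℕ × List Bool × ℕ) × ℕ × ℕ × ℕ × RunWitness => x.2.1 :=
    Computable.fst.comp Computable.snd
  have h2 : Computable fun x : (ℕ × List Bool × ℕ) × ℕ × ℕ × ℕ × RunWitness => x.2.2 :=
    Computable.snd.comp Computable.snd
  exact computable_and (computable_decide_eq (Computable.list_getElem?.comp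
    (computable_rightWord.comp hw) h1) (Computable.const _))
    (computable_acceptsBall ha (computable_leftWord.comp hw) ((Computable.ofNat _).comp h1)
      ((Computable.fst.comp h2).pair (Computable.fst.comp Computable.fst))
      (Computable.snd.comp h2))

lemma computable_evalCentre : Computable evalCentre :=
  Computable.option_getD (Computable.option_map Computable.decode
    ((Computable.fst.comp (Computable.snd.comp Computable.fst)).comp Computable.snd))
    (Computable.const 0)

lemma exists_evalTest {a : ℕ × ℕ × ℕ → ℕ} {r g : Cantor} {m k c n : ℕ} {s : ℕ × RunWitness}
    (hg : natRep.names g m)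
    (h : acceptsBall a (r.pre n) (Denumerable.ofNat (ℕ × List (ℕ × ℕ)) m) (c, k) s = true) :
    ∃ t, evalTest a k ((r.pair g).pre t) t = true := by
  refine ⟨Encodable.encode ((m, c, s), 2 * (n + m + 1)), ?_⟩
  have hle : 2 * (n + m + 1) ≤ Encodable.encode ((m, c, s), 2 * (n + m + 1)) :=
    le_encode_prod_right _ _
  rw [evalTest, codedTest_encode, leftWord_pre, rightWord_pre, Cantor.left_pair,
    Cantor.right_pair, Bool.and_eq_true, decide_eq_true_eq, Cantor.getElem?_pre_eq_some_true]
  generalize Encodable.encode ((m, c, s), 2 * (n + m + 1)) = t at hle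
  exact ⟨⟨by omega, (hg m).2 rfl⟩, acceptsBall_mono (by omega) h⟩

lemma exists_acceptsBall_of_evalTest {a : ℕ × ℕ × ℕ → ℕ} {r g : Cantor} {m k t : ℕ}
    (hg : natRep.names g m) (h : evalTest a k ((r.pair g).pre t) t = true) :
    ∃ n s, acceptsBall a (r.pre n) (Denumerable.ofNat (ℕ × List (ℕ × ℕ)) m)
      (evalCentre t, k) s = true := by
  obtain ⟨⟨m', c, s⟩, n, hd, h⟩ := exists_of_codedTest h
  rw [leftWord_pre, rightWord_pre, Cantor.left_pair,
    Cantor.right_pair, Bool.and_eq_true, decide_eq_true_eq, Cantor.getElem?_pre_eq_some_true,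
    hg] at h
  obtain ⟨⟨-, rfl⟩, h⟩ := h
  exact ⟨_, s, by simpa only [evalCentre, hd, Option.map_some, Option.getD_some] using h⟩

end CompAnalysis

theorem theorem7 {X : Type u} {Y : Type v}
    [CompAnalysis.ComputableMetricSpace X] [CompAnalysis.ComputableMetricSpace Y] :
    CompAnalysis.WeihrauchReducible
      (CompAnalysis.prodRep
        (CompAnalysis.delta2FunRep (CompAnalysis.cauchyRep X) (CompAnalysis.cauchyRep Y)
          (CompAnalysis.cauchyRep_isT0 Y))
        (CompAnalysis.cauchyRep X))
      (CompAnalysis.cauchyRep Y)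
      (CompAnalysis.closedRep CompAnalysis.natRep)
      CompAnalysis.natRep
      (CompAnalysis.delta2Eval (CompAnalysis.cauchyRep X) (CompAnalysis.cauchyRep Y))
      (CompAnalysis.closedChoice CompAnalysis.natRep) := by
  obtain ⟨a, hac, ha⟩ := CompAnalysis.ComputableMetricSpace.computable_dist (X := Y)
  obtain ⟨φ, hφc, hφm, hφ⟩ := CompAnalysis.exists_search_machine
    (CompAnalysis.computable_evalTest hac) CompAnalysis.computable_evalCentre
  refine ⟨fun p => ⟨∃ q, CompAnalysis.Produces φ p q, fun h => h.choose⟩, _,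
    ⟨φ, hφc, hφm, ?_⟩,
    CompAnalysis.computableFun_graphName (CompAnalysis.computable_rejectBit hac), ?_⟩
  · rintro p q ⟨h, rfl⟩
    exact h.choose_spec
  · rintro G hG r ⟨⟨f, hf'⟩, x⟩ ⟨hf, hx⟩ -
    have hA := CompAnalysis.namesFun_rejected a r
    obtain ⟨iw, hiw⟩ := CompAnalysis.exists_not_rejects ha hf hx
    obtain ⟨g, hgG, m, hm, hgm⟩ := hG _ ⟨_, _, hA⟩ hA
      ⟨Encodable.encode iw, by
        change ¬ _
        rwa [Denumerable.ofNat_encode]⟩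
    have hsearch : ∀ k, ∃ t, CompAnalysis.evalTest a k ((r.pair g).pre t) t = true := by
      intro k
      obtain ⟨c, hc⟩ := CompAnalysis.exists_mem_ratBall (f x) k
      obtain ⟨s, n, h⟩ := CompAnalysis.exists_acceptsBall ha hf hx
        (Denumerable.ofNat (ℕ × List (ℕ × ℕ)) m) hc
      exact CompAnalysis.exists_evalTest hgm h
    obtain ⟨q, s, hq, hs, hst⟩ := hφ (r.pair g) hsearch
    refine ⟨q, ?_, f x, rfl, s, hs, fun k => ?_⟩
    · simp only [Part.bind_some, Part.mem_bind_iff]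
      exact ⟨g, hgG, ⟨q, hq⟩, (Exists.choose_spec (⟨q, hq⟩ : ∃ q, _)).unique hφm hq⟩
    · obtain ⟨t, ht, hk⟩ := hst k
      obtain ⟨n, s', h⟩ := CompAnalysis.exists_acceptsBall_of_evalTest hgm ht
      rw [hk]
      simpa only using CompAnalysis.dist_le_of_acceptsBall ha hf hx hm h
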